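/- Let $V$ be a finite index set and let $P$ be the distribution of a real random vector $(X_v)_{v\in V}$. Assume that $P$ is Gaussian and regular, meaning that its covariance matrix $\Sigma=(\operatorname{Cov}(X_u,X_v))_{u,v\in V}$ is positive definite, and that $P$ is exchangeable, meaning that for every permutation $\pi$ of $V$ the vector $(X_{\pi(v)})_{v\in V}$ also has distribution $P$. For $A\subseteq V$ write $X_A=(X_v)_{v\in A}$. Then the following holds. 1. If $\Sigma_{uv}=0$ for some $u\ne v$ in $V$, then all components are completely independent: for all disjoint non-empty $A,B\subseteq V$ and every $C\subseteq V\setminus(A\cup B)$ (including $C=\varnothing$), $X_A$ and $X_B$ are conditionally independent given $X_C$. 2. Otherwise all components are completely dependent: for all disjoint non-empty $A,B\subseteq V$ and every $C\subseteq V\setminus(A\cup B)$ (including $C=\varnothing$), $X_A$ and $X_B$ are not conditionally independent given $X_C$. In particular, taking $A=\{u\}$ and $B=\{v\}$ with $u\neq v$: in the first case $X_u$ and $X_v$ are conditionally independent given $X_C$ for every $C\subseteq V\setminus\{u,v\}$, and in the second case for no such $C$. -/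

import Mathlib

open MeasureTheory ProbabilityTheory

/-- The distribution `P` of a vector `(X_v)_{v ∈ V}` with common state space `S` is (finitely)
exchangeable: permuting the components does not change the distribution. -/
def Exchangeable {V S : Type*} [MeasurableSpace S] (P : Measure (V → S)) : Prop :=
  ∀ π : Equiv.Perm V, P.map (fun x v => x (π v)) = P

/-- The covariance matrix of a distribution on `ℝ^V`; the component `X_v` is the coordinate
map `x ↦ x v`. -/
noncomputable def covMatrix {V : Type*} (P : Measure (V → ℝ)) : Matrix V V ℝ :=
  Matrix.of fun u v => cov[fun x : V → ℝ => x u, fun x : V → ℝ => x v; P]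

/-- A regular Gaussian distribution on `ℝ^V`: it is Gaussian and its covariance matrix is
positive definite. -/
def IsRegularGaussian {V : Type*} [Fintype V] (P : Measure (V → ℝ)) : Prop :=
  IsGaussian P ∧ (covMatrix P).PosDef

/-- `X_A` is conditionally independent of `X_B` given `X_C` with respect to `P`, where
`X_A = (X_v)_{v ∈ A}` is the restriction of the vector to the components in `A`. -/
def SubvectorCondIndep {V : Type*} [Fintype V] (P : Measure (V → ℝ)) [IsFiniteMeasure P]
    (A B C : Finset V) : Prop :=
  CondIndepFun (MeasurableSpace.comap (C.restrict (π := fun _ : V => ℝ)) inferInstance)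
    (Finset.measurable_restrict C).comap_le
    (A.restrict (π := fun _ : V => ℝ)) (B.restrict (π := fun _ : V => ℝ)) P

/-- `A` and `B` are completely independent: `X_A` and `X_B` are conditionally independent given
`X_C` for every `C ⊆ V ∖ (A ∪ B)`, including `C = ∅`. -/
def CompletelyIndependent {V : Type*} [Fintype V] [DecidableEq V] (P : Measure (V → ℝ))
    [IsFiniteMeasure P] (A B : Finset V) : Prop :=
  ∀ C : Finset V, C ⊆ Finset.univ \ (A ∪ B) → SubvectorCondIndep P A B C

/-- `A` and `B` are completely dependent: there is no `C ⊆ V ∖ (A ∪ B)`, `C = ∅` included, such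
that `X_A` and `X_B` are conditionally independent given `X_C`. -/
def CompletelyDependent {V : Type*} [Fintype V] [DecidableEq V] (P : Measure (V → ℝ))
    [IsFiniteMeasure P] (A B : Finset V) : Prop :=
  ∀ C : Finset V, C ⊆ Finset.univ \ (A ∪ B) → ¬ SubvectorCondIndep P A B C

/-! By exchangeability `Σ` has one diagonal value `d` and one off-diagonal value `c`. If `c = 0`,
the Gaussian components are mutually independent, and every conditional independence follows. If `c
≠ 0`, put `r = d - c` and `n = |C|`; positive definiteness gives `r > 0` and `n c + r > 0`. The
regression of any component outside `C` on `X_C` is `k ∑_{i ∈ C} X_i` plus a constant, with `k = c /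
(n c + r)`. Conditional independence of `X_a` and `X_b` would make `c` the covariance of the two
regressions, `k² n (n c + r) = n c² / (n c + r)`, hence `c r = 0`, a contradiction. -/

section CondIndep

variable {Ω : Type*} {m mΩ : MeasurableSpace Ω} [StandardBorelSpace Ω] {hm : m ≤ mΩ}
  {μ : Measure Ω} [IsProbabilityMeasure μ] {X Y : Ω → ℝ}

/-- Conditionally independent variables are independent under almost every regular conditional
probability. -/
theorem ProbabilityTheory.CondIndepFun.ae_indepFun_condExpKernel (hX : Measurable X) (hY : Measurable Y)
    (h : CondIndepFun m hm X Y μ) : ∀ᵐ ω ∂μ, IndepFun X Y (condExpKernel μ m ω) := by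
  rw [condIndepFun_iff_map_prod_eq_prod_map_map hX hY] at h
  filter_upwards [ae_of_ae_trim hm h] with ω hω
  rw [indepFun_iff_map_prod_eq_prod_map_map hX.aemeasurable hY.aemeasurable]
  rwa [Kernel.prod_apply, Kernel.map_apply _ (hX.prodMk hY), Kernel.map_apply _ hX,
    Kernel.map_apply _ hY] at hω

theorem ProbabilityTheory.CondIndepFun.condExp_mul_ae_eq (hX : Measurable X) (hY : Measurable Y)
    (hX2 : MemLp X 2 μ) (hY2 : MemLp Y 2 μ) (h : CondIndepFun m hm X Y μ) :
    μ[X * Y | m] =ᵐ[μ] μ[X | m] * μ[Y | m] := by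
  filter_upwards [h.ae_indepFun_condExpKernel hX hY,
    condExp_ae_eq_integral_condExpKernel hm (hX2.integrable_mul hY2),
    condExp_ae_eq_integral_condExpKernel hm (hX2.integrable one_le_two),
    condExp_ae_eq_integral_condExpKernel hm (hY2.integrable one_le_two)] with ω h₁ h₂ h₃ h₄
  rw [h₂, Pi.mul_apply, h₃, h₄]
  exact h₁.integral_mul_eq_mul_integral hX.aestronglyMeasurable hY.aestronglyMeasurable

/-- The covariance of conditionally independent variables is that of their conditional
expectations. -/
theorem ProbabilityTheory.CondIndepFun.covariance_eq_covariance_condExp (hX : Measurable X) (hY : Measurable Y)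
    (hX2 : MemLp X 2 μ) (hY2 : MemLp Y 2 μ) (h : CondIndepFun m hm X Y μ) :
    cov[X, Y; μ] = cov[μ[X | m], μ[Y | m]; μ] := by
  -- By the tower property both covariances have the same product of means; only the conditional
  -- factorisation of `X * Y` is left.
  rw [covariance_eq_sub hX2 hY2, covariance_eq_sub (hX2.condExp one_le_two) (hY2.condExp one_le_two), integral_condExp hm,
    integral_condExp hm, ← integral_condExp hm (f := X * Y),
    integral_congr_ae (h.condExp_mul_ae_eq hX hY hX2 hY2)]

/-- If the pair `(X, Y)` is independent of `Z`, then `X` and `Y` are conditionally independent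
given `Z` as soon as they are independent. -/
theorem condIndepFun_of_indepFun_prodMk {α β γ : Type*} [MeasurableSpace α] [MeasurableSpace β]
    [MeasurableSpace γ] {f : Ω → α} {g : Ω → β} {k : Ω → γ} (hf : Measurable f)
    (hg : Measurable g) (hk : Measurable k) (hfg : IndepFun f g μ)
    (hfgk : IndepFun (fun ω => (f ω, g ω)) k μ) :
    CondIndepFun (MeasurableSpace.comap k inferInstance) hk.comap_le f g μ := by
  rw [condIndepFun_iff_condExp_inter_preimage_eq_mul hf hg]
  intro s t hs ht
  -- Events of the pair are independent of `k`, so their conditional probabilities are constants;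
  -- rectangles then reduce the claim to unconditional independence.
  have key : ∀ u : Set (α × β), MeasurableSet u →
      μ⟦(fun ω => (f ω, g ω)) ⁻¹' u | MeasurableSpace.comap k inferInstance⟧ =ᵐ[μ]
        fun _ => μ.real ((fun ω => (f ω, g ω)) ⁻¹' u) := by
    intro u hu
    have h := condExp_indep_eq (hf.prodMk hg).comap_le hk.comap_le
      (stronglyMeasurable_const.indicator ⟨u, hu, rfl⟩ :
        StronglyMeasurable[MeasurableSpace.comap (fun ω => (f ω, g ω)) inferInstance]
          (((fun ω => (f ω, g ω)) ⁻¹' u).indicator fun _ => (1 : ℝ))) hfgk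
    refine h.trans (.of_eq ?_)
    ext
    simpa using integral_indicator_const (1 : ℝ) ((hf.prodMk hg) hu)
  have h₁ := key (s ×ˢ t) (hs.prod ht)
  have h₂ := key (s ×ˢ Set.univ) (hs.prod .univ)
  have h₃ := key (Set.univ ×ˢ t) (MeasurableSet.univ.prod ht)
  simp only [Set.mk_preimage_prod, Set.preimage_univ, Set.inter_univ, Set.univ_inter]
    at h₁ h₂ h₃
  filter_upwards [h₁, h₂, h₃] with ω h₁ h₂ h₃
  rw [h₁, h₂, h₃, measureReal_def, hfg.measure_inter_preimage_eq_mul s t hs ht,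
    ENNReal.toReal_mul, measureReal_def, measureReal_def]

end CondIndep

/-- The quadratic form of a matrix with constant diagonal and constant off-diagonal entries. -/
theorem dotProduct_mulVec_of_const_offDiag {V : Type*} [Fintype V] [DecidableEq V]
    {M : Matrix V V ℝ} {c d : ℝ} (hM : ∀ u v, M u v = c + if u = v then d - c else 0)
    (x : V → ℝ) :
    dotProduct x (M.mulVec x) = c * (∑ v, x v) ^ 2 + (d - c) * ∑ v, x v ^ 2 := by
  have h : ∀ u, M.mulVec x u = c * ∑ v, x v + (d - c) * x u := by
    intro u
    simp [Matrix.mulVec, dotProduct, hM, add_mul, Finset.sum_add_distrib, Finset.mul_sum]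
  calc dotProduct x (M.mulVec x)
      = ∑ u, (c * (∑ v, x v) * x u + (d - c) * x u ^ 2) :=
        Finset.sum_congr rfl fun u _ => by rw [h]; ring
    _ = _ := by rw [Finset.sum_add_distrib, ← Finset.mul_sum, ← Finset.mul_sum]; ring

/-- The quadratic form is tested on `e_a - e_b`, with value `2 (d - c)`, and on the indicator of
`C`, with value `|C| (|C| c + d - c)`. -/
theorem posDef_const_offDiag {V : Type*} [Fintype V] [DecidableEq V]
    {M : Matrix V V ℝ} {c d : ℝ} (hM : ∀ u v, M u v = c + if u = v then d - c else 0)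
    (hpos : M.PosDef) {a b : V} (hab : a ≠ b) :
    0 < d - c ∧ ∀ C : Finset V, 0 < C.card * c + (d - c) := by
  have hq : ∀ x : V → ℝ, x ≠ 0 → 0 < c * (∑ v, x v) ^ 2 + (d - c) * ∑ v, x v ^ 2 := by
    intro x hx
    rw [← dotProduct_mulVec_of_const_offDiag hM]
    simpa using hpos.dotProduct_mulVec_pos hx
  have hdc : 0 < d - c := by
    have h := hq (Pi.single a 1 - Pi.single b 1) fun h => by
      simpa [hab] using congrFun h a
    have h2 : ∑ v, (Pi.single a (1 : ℝ) - Pi.single b 1 : V → ℝ) v ^ 2 = 2 := by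
      rw [← Finset.sum_subset (Finset.subset_univ {a, b}), Finset.sum_pair hab]
      · simp [hab, hab.symm]; norm_num
      · intro v _ hv
        simp only [Finset.mem_insert, Finset.mem_singleton, not_or] at hv
        simp [hv.1, hv.2]
    rw [h2] at h
    simp [Finset.sum_sub_distrib] at h
    linarith
  refine ⟨hdc, fun C => ?_⟩
  rcases C.eq_empty_or_nonempty with rfl | hC
  · simpa using hdc
  have h := hq (fun v => if v ∈ C then 1 else 0) fun h => by
    obtain ⟨v, hv⟩ := hC
    simpa [hv] using congrFun h v
  simp only [ite_pow, one_pow, ne_eq, OfNat.ofNat_ne_zero, not_false_eq_true, zero_pow,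
    Finset.sum_ite_mem, Finset.univ_inter, Finset.sum_const, nsmul_eq_mul, mul_one] at h
  have hn : (0 : ℝ) < C.card := by exact_mod_cast hC.card_pos
  exact pos_of_mul_pos_right (by linarith : 0 < (C.card : ℝ) * (C.card * c + (d - c))) hn.le

/-! ### Covariance under exchangeability -/

theorem Exchangeable.covMatrix_perm {V : Type*} [Fintype V] {P : Measure (V → ℝ)}
    (h : Exchangeable P) (π : Equiv.Perm V) (u v : V) :
    covMatrix P (π u) (π v) = covMatrix P u v := by
  have hπ : Measurable fun (x : V → ℝ) v => x (π v) := by fun_prop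
  simp only [covMatrix, Matrix.of_apply]
  conv_rhs => rw [← h π]
  rw [covariance_map_fun (measurable_pi_apply u).aestronglyMeasurable
    (measurable_pi_apply v).aestronglyMeasurable hπ.aemeasurable]

theorem Exchangeable.covMatrix_eq {V : Type*} [Fintype V] [DecidableEq V] {P : Measure (V → ℝ)}
    (h : Exchangeable P) {a b : V} (hab : a ≠ b) (u v : V) :
    covMatrix P u v =
      covMatrix P a b + if u = v then covMatrix P a a - covMatrix P a b else 0 := by
  split_ifs with huv
  · subst huv
    rw [← h.covMatrix_perm (Equiv.swap a u) a a, Equiv.swap_apply_left]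
    ring
  · have h1 : Equiv.swap a u b ≠ u := fun e =>
      hab ((Equiv.swap a u).injective ((Equiv.swap_apply_left a u).trans e.symm))
    -- The first swap sends `a` to `u`; the second moves the image of `b` to `v` and fixes `u`.
    rw [← h.covMatrix_perm ((Equiv.swap a u).trans (Equiv.swap (Equiv.swap a u b) v)) a b]
    simp only [Equiv.trans_apply, Equiv.swap_apply_left]
    rw [Equiv.swap_apply_of_ne_of_ne h1.symm huv, add_zero]

/-! ### Gaussian independence and regression -/

section Gaussian

variable {V : Type*} {P : Measure (V → ℝ)}

theorem hasGaussianLaw_eval (hP : IsGaussian P) :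
    HasGaussianLaw (fun (x : V → ℝ) v => x v) P :=
  IsGaussian.hasGaussianLaw_id

variable [Fintype V] [IsProbabilityMeasure P]

theorem subvectorCondIndep_of_covMatrix_eq_zero (hP : IsGaussian P)
    (h : ∀ u v, u ≠ v → covMatrix P u v = 0) [DecidableEq V] {A B C : Finset V}
    (hAB : Disjoint A B) (hC : C ⊆ Finset.univ \ (A ∪ B)) : SubvectorCondIndep P A B C := by
  have hi : iIndepFun (fun (v : V) (x : V → ℝ) => x v) P :=
    (hasGaussianLaw_eval hP).iIndepFun_of_covariance_eq_zero h
  have hABC : Disjoint (A ∪ B) C :=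
    (Finset.disjoint_of_subset_left hC Finset.sdiff_disjoint).symm
  have h2 := hi.indepFun_finset (A ∪ B) C hABC fun v => measurable_pi_apply v
  refine condIndepFun_of_indepFun_prodMk (Finset.measurable_restrict A)
    (Finset.measurable_restrict B) (Finset.measurable_restrict C)
    (hi.indepFun_finset A B hAB fun v => measurable_pi_apply v) ?_
  exact h2.comp (φ := fun y : (A ∪ B : Finset V) → ℝ =>
      ((fun i : A => y ⟨i, Finset.mem_union_left B i.2⟩),
        fun i : B => y ⟨i, Finset.mem_union_right A i.2⟩)) (ψ := id)
    (by fun_prop) measurable_id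

/-- If `X_a - k ∑_{i ∈ C} X_i` is uncorrelated with `X_C`, then `k ∑_{i ∈ C} X_i` is, up to a
constant, the conditional expectation of `X_a` given `X_C`. -/
theorem condExp_eval_ae_eq (hP : IsGaussian P) (a : V) (C : Finset V) (k : ℝ)
    (hk : ∀ j ∈ C, covMatrix P a j = k * ∑ i ∈ C, covMatrix P i j) :
    ∃ e : ℝ, P[fun x => x a | MeasurableSpace.comap (C.restrict (π := fun _ : V => ℝ))
      inferInstance] =ᵐ[P] fun x => e + k * ∑ i ∈ C, x i := by
  have hG := hasGaussianLaw_eval hP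
  have hL2 : ∀ v, MemLp (fun x : V → ℝ => x v) 2 P := fun v => (hG.eval v).memLp_two
  have hS2 : MemLp (fun x : V → ℝ => k * ∑ i ∈ C, x i) 2 P :=
    (memLp_finsetSum C fun v _ => hL2 v).const_mul k
  -- Residual and `X_C` are jointly Gaussian as a linear image of the vector, so being uncorrelated
  -- makes them independent. The index type `Unit` presents the residual as a family, the form the
  -- independence criterion takes.
  let L : (V → ℝ) →L[ℝ] (Unit → ℝ) × (C → ℝ) :=
    (ContinuousLinearMap.pi fun _ => ContinuousLinearMap.proj a - k • ∑ i ∈ C,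
      ContinuousLinearMap.proj i).prod (ContinuousLinearMap.pi fun j => ContinuousLinearMap.proj j.1)
  have hLG : HasGaussianLaw (fun x : V → ℝ =>
      ((fun _ : Unit => x a - k * ∑ i ∈ C, x i), fun j : C => x j)) P := by
    refine (hG.map_fun L).congr (.of_eq ?_)
    funext x
    refine Prod.ext ?_ rfl
    funext _
    simp [L]
  have hind := hLG.indepFun_of_covariance_eval (X := fun (_ : Unit) (x : V → ℝ) => x a - k * ∑ i ∈ C, x i)
    (Y := fun (j : C) (x : V → ℝ) => x j) <| by
      intro _ j
      rw [covariance_fun_sub_left (hL2 a) hS2 (hL2 j), covariance_const_mul_left,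
        covariance_fun_sum_left' (fun i _ => hL2 i) (hL2 j)]
      exact sub_eq_zero.2 (hk j j.2)
  have hR : StronglyMeasurable[MeasurableSpace.comap
      (fun (x : V → ℝ) (_ : Unit) => x a - k * ∑ i ∈ C, x i) inferInstance]
      fun x : V → ℝ => x a - k * ∑ i ∈ C, x i :=
    ((measurable_pi_apply (X := fun _ : Unit => ℝ) ()).comp
      (comap_measurable fun (x : V → ℝ) (_ : Unit) => x a - k * ∑ i ∈ C, x i)).stronglyMeasurable
  have hS : StronglyMeasurable[MeasurableSpace.comap (C.restrict (π := fun _ : V => ℝ))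
      inferInstance] fun x : V → ℝ => k * ∑ i ∈ C, x i := by
    have : Measurable fun y : C → ℝ => k * ∑ i, y i := by fun_prop
    convert (this.comp (comap_measurable (C.restrict (π := fun _ : V => ℝ)))).stronglyMeasurable
      using 1
    ext x
    exact congrArg (k * ·) (Finset.sum_coe_sort C fun i => x i).symm
  have h1 := condExp_indep_eq (μ := P) (by fun_prop : Measurable _).comap_le
    (Finset.measurable_restrict C).comap_le hR hind
  -- The constant is the mean of the residual, which is also its conditional expectation by
  -- independence.
  refine ⟨P[fun x => x a - k * ∑ i ∈ C, x i], ?_⟩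
  have h2 := condExp_add (((hL2 a).sub hS2).integrable one_le_two) (hS2.integrable one_le_two)
    (MeasurableSpace.comap (C.restrict (π := fun _ : V => ℝ)) inferInstance)
  rw [condExp_of_stronglyMeasurable (Finset.measurable_restrict C).comap_le hS
    (hS2.integrable one_le_two)] at h2
  have h3 : (fun x : V → ℝ => x a) = ((fun x : V → ℝ => x a) - fun x => k * ∑ i ∈ C, x i) +
      fun x => k * ∑ i ∈ C, x i := by simp
  rw [h3]
  filter_upwards [h1, h2] with x h1 h2
  rw [h2, Pi.add_apply]
  exact congrArg (· + k * ∑ i ∈ C, x i) h1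

/-- If `X_a` and `X_b` are conditionally independent given `X_C` and have the same linear
regression on `∑_{i ∈ C} X_i`, then their covariance is explained by that regression. -/
theorem covMatrix_eq_of_subvectorCondIndep (hP : IsGaussian P) {A B C : Finset V} {a b : V}
    (ha : a ∈ A) (hb : b ∈ B) (h : SubvectorCondIndep P A B C) (k : ℝ)
    (hka : ∀ j ∈ C, covMatrix P a j = k * ∑ i ∈ C, covMatrix P i j)
    (hkb : ∀ j ∈ C, covMatrix P b j = k * ∑ i ∈ C, covMatrix P i j) :
    covMatrix P a b = k ^ 2 * ∑ i ∈ C, ∑ j ∈ C, covMatrix P i j := by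
  have hL2 : ∀ v, MemLp (fun x : V → ℝ => x v) 2 P :=
    fun v => ((hasGaussianLaw_eval hP).eval v).memLp_two
  have hS2 : MemLp (fun x : V → ℝ => k * ∑ i ∈ C, x i) 2 P :=
    (memLp_finsetSum C fun v _ => hL2 v).const_mul k
  have hcond := CondIndepFun.comp h (measurable_pi_apply (⟨a, ha⟩ : A))
    (measurable_pi_apply (⟨b, hb⟩ : B))
  have hcov := CondIndepFun.covariance_eq_covariance_condExp (measurable_pi_apply a)
    (measurable_pi_apply b) (hL2 a) (hL2 b) hcond
  obtain ⟨e, he⟩ := condExp_eval_ae_eq hP a C k hka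
  obtain ⟨f, hf⟩ := condExp_eval_ae_eq hP b C k hkb
  have hcongr : cov[P[fun x => x a | MeasurableSpace.comap (C.restrict (π := fun _ : V => ℝ))
      inferInstance], P[fun x => x b | MeasurableSpace.comap (C.restrict (π := fun _ : V => ℝ))
      inferInstance]; P] = cov[fun x => e + k * ∑ i ∈ C, x i, fun x => f + k * ∑ i ∈ C, x i; P] := by
    unfold covariance
    rw [integral_congr_ae he, integral_congr_ae hf]
    refine integral_congr_ae ?_
    filter_upwards [he, hf] with x he hf
    rw [he, hf]
  rw [hcongr, covariance_const_add_left (hS2.integrable one_le_two),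
    covariance_const_add_right (hS2.integrable one_le_two), covariance_const_mul_left,
    covariance_const_mul_right, covariance_fun_sum_fun_sum' (fun i _ => hL2 i)
      (fun i _ => hL2 i)] at hcov
  change cov[fun x => x a, fun x => x b; P] = _
  rw [hcov]
  simp only [covMatrix, Matrix.of_apply]
  ring

end Gaussian

theorem mainTheorem3 {V : Type*} [Fintype V] [DecidableEq V]
    (P : Measure (V → ℝ)) [IsProbabilityMeasure P]
    (hgauss : IsRegularGaussian P) (hexch : Exchangeable P) :
    ((∃ u v : V, u ≠ v ∧ covMatrix P u v = 0) →
      ∀ A B : Finset V, A.Nonempty → B.Nonempty → Disjoint A B →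
        CompletelyIndependent P A B) ∧
    ((¬ ∃ u v : V, u ≠ v ∧ covMatrix P u v = 0) →
      ∀ A B : Finset V, A.Nonempty → B.Nonempty → Disjoint A B →
        CompletelyDependent P A B) := by
  obtain ⟨hP, hpos⟩ := hgauss
  constructor
  · rintro ⟨u, v, huv, h0⟩ A B - - hAB C hC
    refine subvectorCondIndep_of_covMatrix_eq_zero hP (fun s t hst => ?_) hAB hC
    rw [hexch.covMatrix_eq huv, if_neg hst, h0, add_zero]
  · rintro hne A B ⟨a, ha⟩ ⟨b, hb⟩ hAB C hC hind
    have hab : a ≠ b := hAB.forall_ne_finset ha hb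
    have hc : covMatrix P a b ≠ 0 := fun h0 => hne ⟨a, b, hab, h0⟩
    have hM := hexch.covMatrix_eq hab
    obtain ⟨hdc, hq⟩ := posDef_const_offDiag hM hpos hab
    replace hq := (hq C).ne'
    generalize covMatrix P a a - covMatrix P a b = r at hM hdc hq
    generalize hcdef : covMatrix P a b = c at hM hc hq
    have haC : a ∉ C := fun h => (Finset.mem_sdiff.1 (hC h)).2 (Finset.mem_union_left _ ha)
    have hbC : b ∉ C := fun h => (Finset.mem_sdiff.1 (hC h)).2 (Finset.mem_union_right _ hb)
    have hsum : ∀ j ∈ C, ∑ i ∈ C, covMatrix P i j = C.card * c + r := by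
      intro j hj
      simp [hM, Finset.sum_add_distrib, hj]
    -- The coefficient solves the normal equations `c = k (n c + r)`, identical for all `j ∈ C`.
    have hk : ∀ s ∉ C, ∀ j ∈ C,
        covMatrix P s j = c / (C.card * c + r) * ∑ i ∈ C, covMatrix P i j := by
      intro s hs j hj
      rw [hsum j hj, div_mul_cancel₀ _ hq, hM, if_neg (ne_of_mem_of_not_mem hj hs).symm, add_zero]
    have key := covMatrix_eq_of_subvectorCondIndep hP ha hb hind _ (hk a haC) (hk b hbC)
    have hss : ∑ i ∈ C, ∑ j ∈ C, covMatrix P i j = ∑ j ∈ C, ∑ i ∈ C, covMatrix P i j :=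
      Finset.sum_comm
    rw [hss, Finset.sum_congr rfl hsum, Finset.sum_const, nsmul_eq_mul, hcdef] at key
    rw [div_pow, div_mul_eq_mul_div, eq_div_iff (pow_ne_zero 2 hq)] at key
    -- With `q = n c + r`, `key` reads `c q² = c² n q`, that is `c q r = 0`.
    exact mul_ne_zero (mul_ne_zero hc hq) hdc.ne' (by linear_combination key)
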